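/- For positive integers $n,m$ let $T_{n,m}=\mathbb Z/n\mathbb Z\times\mathbb Z/m\mathbb Z$, viewed as a directed graph in which each vertex $(x,y)$ has two outgoing edges, one to $(x+1,y)$ and one to $(x,y+1)$. A cycle-rooted spanning forest (CRSF) of $T_{n,m}$ is obtained by choosing exactly one of the two outgoing edges at every vertex; its cycles are the directed cycles formed by the chosen edges, that is, the periodic orbits of the map sending each vertex to the endpoint of its chosen edge. Let $\mathbb P$ be the uniform probability measure on the $2^{nm}$ CRSFs of $T_{n,m}$ (equivalently, the edges are chosen independently with probability $1/2$ each). Let $C\in\mathbb R$ with $|C|>\sqrt2$, and let $m=m(n)$ be positive integers with $m=n+C\sqrt{n\log n}\,(1+o(1))$ as $n\to\infty$. Then for each $\epsilon>0$ there is $n_0$ such that for all $n\ge n_0$, in the CRSF on $T_{n,m}$, $$\mathbb P\big(\text{there exist at least two disjoint cycles}\big)\le n^{\frac12-\frac{C^2}{4}+\epsilon}.$$ -/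

import Mathlib

open Filter Topology MeasureTheory ProbabilityTheory

namespace CRSF

/-- The `n, m`-torus `ℤ² / ⟨(n, 0), (0, m)⟩`. -/
abbrev Torus (n m : ℕ) : Type := ZMod n × ZMod m

/-- A cycle-rooted spanning forest on the torus: each vertex `v` has exactly one outgoing edge,
which is the edge to the east if `σ v = true` and the edge to the north if `σ v = false`. -/
abbrev Forest (n m : ℕ) : Type := Torus n m → Bool

/-- The dynamical system `φ` of a forest: `φ (x, y)` is the vertex that the outgoing edge of
`(x, y)` points to, either `(x + 1, y)` or `(x, y + 1)`. -/
def next {n m : ℕ} (σ : Forest n m) (v : Torus n m) : Torus n m :=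
  if σ v = true then (v.1 + 1, v.2) else (v.1, v.2 + 1)

/-- `c` is the vertex set of a directed cycle of the forest, that is, the orbit under `φ` of some
periodic point. -/
def IsCycle {n m : ℕ} (σ : Forest n m) (c : Set (Torus n m)) : Prop :=
  ∃ v ∈ Function.periodicPts (next σ), c = Set.range fun k : ℕ => (next σ)^[k] v

/-- The uniform probability measure on cycle-rooted spanning forests (for `n, m ≥ 1`). -/
noncomputable def crsfMeasure (n m : ℕ) : Measure (Forest n m) := uniformOn Set.univ

/-- The event that there are at least two disjoint cycles. -/
def twoDisjointCycles (n m : ℕ) : Set (Forest n m) :=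
  {σ | ∃ c₁ c₂ : Set (Torus n m), IsCycle σ c₁ ∧ IsCycle σ c₂ ∧ Disjoint c₁ c₂}

end CRSF


/-!
Read the forest along an orbit: as long as the vertices visited are distinct, the edges met are
independent fair coins, so that the orbit performs a simple north-east random walk.

A short cycle, of length less than `n ^ (7 / 5)`, winds `i` times around the torus to the east and
`j` times to the north. If `i = j = k`, its walk goes from the origin to `(k n, k m)`; each
of the `m` possible starting points on the column `x = 0` contributes a probability of order
`n ^ (-1 / 2) * exp (-k (m - n) ^ 2 / (4 n))`, and the geometric series in `k` gives
`n ^ (1 / 2 - C ^ 2 / 4 + o(1))`. If `i ≠ j`, the endpoint is at distance of order `n` from the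
diagonal, and the probability is smaller than every power of `n`.

If instead two disjoint cycles are long, follow two of their vertices that are consecutive along an
antidiagonal. Their orbits are independent and never meet, so the gap between them is a lazy random
walk that stays positive. The gaps cut out disjoint arcs of antidiagonals, hence sum to at most
`n m`, and over `L = n ^ (7 / 5)` steps their average is at most of order `R = n ^ (3 / 5)`. A walk
can only keep such a low profile with probability `exp (-c L / R ^ 2)`, again smaller than every
power of `n`.
-/

namespace CRSF

/-! ### Adaptive exploration -/

section Exploration

variable {α β ι : Type*}

/-- A rule `X` selecting sites `X σ i` of a configuration `σ` is an adaptive exploration if the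
values read at the selected sites determine which sites are selected. No order of exploration is
recorded: only this consequence of selecting the sites one after the other is needed. -/
def IsAdaptive (X : (α → β) → ι → α) : Prop :=
  ∀ ⦃σ σ' : α → β⦄, σ ∘ X σ = σ' ∘ X σ' → X σ = X σ'

variable [Fintype β] [Fintype ι]

theorem ncard_comp_eq_mul [Fintype α] {u : ι → α} (hu : Function.Injective u) (s : ι → β) :
    {σ : α → β | σ ∘ u = s}.ncard * Fintype.card β ^ Fintype.card ι =
      Fintype.card β ^ Fintype.card α := by
  classical
  let e := Equiv.ofInjective u hu
  have hiff (σ : α → β) : σ ∘ u = s ↔ σ ∘ ((↑) : Set.range u → α) = s ∘ e.symm := by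
    rw [Equiv.eq_comp_symm]
    rfl
  have extensions : {σ : α → β | σ ∘ u = s} ≃ ({a // a ∉ Set.range u} → β) :=
    (Equiv.subtypeEquivRight hiff).trans (Equiv.subtypePreimage _ _)
  rw [← Nat.card_coe_set_eq, Nat.card_congr extensions, Nat.card_eq_fintype_card,
    Fintype.card_fun, Fintype.card_subtype_compl, ← Fintype.card_congr e, ← pow_add,
    Nat.sub_add_cancel (Fintype.card_le_of_injective u hu)]

variable [Finite α] [Nonempty β] [MeasurableSpace β] [MeasurableSingletonClass β]

theorem uniformOn_univ_real_comp_eq {u : ι → α} (hu : Function.Injective u) (s : ι → β) :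
    (uniformOn (Set.univ : Set (α → β))).real {σ | σ ∘ u = s} =
      1 / (Fintype.card β : ℝ) ^ Fintype.card ι := by
  have := Fintype.ofFinite α
  have hcard : ({σ : α → β | σ ∘ u = s}.ncard : ℝ) * (Fintype.card β : ℝ) ^ Fintype.card ι =
      (Fintype.card β : ℝ) ^ Fintype.card α := mod_cast ncard_comp_eq_mul hu s
  have : (0 : ℝ) < Fintype.card β := by exact_mod_cast Fintype.card_pos
  classical
  rw [measureReal_def, uniformOn_univ, Measure.count_apply (Set.toFinite _).measurableSet,
    ← Set.Finite.cast_ncard_eq (Set.toFinite _), ENat.toENNReal_coe, ENNReal.toReal_div,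
    ENNReal.toReal_natCast, ENNReal.toReal_natCast, Fintype.card_fun, Nat.cast_pow]
  field_simp
  exact hcard

theorem uniformOn_univ_real_explore_le {X : (α → β) → ι → α} (hX : IsAdaptive X)
    (S : Finset (ι → β)) :
    (uniformOn (Set.univ : Set (α → β))).real {σ | Function.Injective (X σ) ∧ σ ∘ X σ ∈ S} ≤
      S.card / (Fintype.card β : ℝ) ^ Fintype.card ι := by
  have := isProbabilityMeasure_uniformOn (Set.finite_univ (α := α → β)) Set.univ_nonempty
  have hfiber (s : ι → β) : (uniformOn (Set.univ : Set (α → β))).real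
      {σ | Function.Injective (X σ) ∧ σ ∘ X σ = s} ≤
        1 / (Fintype.card β : ℝ) ^ Fintype.card ι := by
    rcases Set.eq_empty_or_nonempty {σ : α → β | Function.Injective (X σ) ∧ σ ∘ X σ = s} with
      hempty | ⟨τ, hτ, hs⟩
    · rw [hempty, measureReal_empty]
      positivity
    · rw [← uniformOn_univ_real_comp_eq hτ s]
      refine measureReal_mono ?_
      rintro σ ⟨-, hσ⟩
      have hXσ : X σ = X τ := hX (hσ.trans hs.symm)
      rwa [hXσ] at hσ
  calc (uniformOn (Set.univ : Set (α → β))).real {σ | Function.Injective (X σ) ∧ σ ∘ X σ ∈ S}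
      ≤ (uniformOn Set.univ).real (⋃ s ∈ S, {σ | Function.Injective (X σ) ∧ σ ∘ X σ = s}) := by
        refine measureReal_mono (fun σ hσ => ?_) (measure_ne_top _ _)
        exact Set.mem_biUnion (x := σ ∘ X σ) hσ.2 ⟨hσ.1, rfl⟩
    _ ≤ ∑ s ∈ S, (uniformOn Set.univ).real {σ | Function.Injective (X σ) ∧ σ ∘ X σ = s} :=
        measureReal_biUnion_finset_le _ _
    _ ≤ S.card • (1 / (Fintype.card β : ℝ) ^ Fintype.card ι) :=
        Finset.sum_le_card_nsmul _ _ _ fun s _ => hfiber s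
    _ = S.card / (Fintype.card β : ℝ) ^ Fintype.card ι := by
        rw [nsmul_eq_mul, mul_one_div]

end Exploration

theorem IsAdaptive.sumElim {α β ι κ : Type*} {X : (α → β) → ι → α} {Y : (α → β) → κ → α}
    (hX : IsAdaptive X) (hY : IsAdaptive Y) : IsAdaptive fun σ => Sum.elim (X σ) (Y σ) := by
  intro σ σ' h
  rw [Sum.comp_elim, Sum.comp_elim] at h
  exact congrArg₂ Sum.elim (hX (congrArg (· ∘ Sum.inl) h)) (hY (congrArg (· ∘ Sum.inr) h))

section Trajectory

variable {n m : ℕ}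

/-- The first `L` vertices visited by the orbit of `v`. -/
def trajectory (σ : Forest n m) (v : Torus n m) (L : ℕ) : Fin L → Torus n m :=
  fun i => (next σ)^[i] v

theorem iterate_next_congr {σ σ' : Forest n m} {v : Torus n m} {t : ℕ}
    (h : ∀ i < t, σ ((next σ)^[i] v) = σ' ((next σ')^[i] v)) :
    (next σ)^[t] v = (next σ')^[t] v := by
  induction t with
  | zero => rfl
  | succ t ih =>
    have ht := h t t.lt_succ_self
    have ih := ih fun i hi => h i (hi.trans t.lt_succ_self)
    rw [Function.iterate_succ_apply', Function.iterate_succ_apply', next, next, ht, ih]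

theorem isAdaptive_trajectory (v : Torus n m) (L : ℕ) :
    IsAdaptive fun σ : Forest n m => trajectory σ v L := by
  intro σ σ' h
  funext i
  exact iterate_next_congr fun j hj => congrFun h ⟨j, hj.trans i.isLt⟩

variable [NeZero n] [NeZero m]

instance isProbabilityMeasure_crsfMeasure : IsProbabilityMeasure (crsfMeasure n m) :=
  isProbabilityMeasure_uniformOn Set.finite_univ Set.univ_nonempty

theorem crsfMeasure_real_trajectory_le (v : Torus n m) (L : ℕ) (S : Finset (Fin L → Bool)) :
    (crsfMeasure n m).real {σ | Function.Injective (trajectory σ v L) ∧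
      σ ∘ trajectory σ v L ∈ S} ≤ S.card / 2 ^ L := by
  simpa using! uniformOn_univ_real_explore_le (isAdaptive_trajectory v L) S

theorem crsfMeasure_real_trajectory_pair_le (v w : Torus n m) (L : ℕ)
    (S : Finset (Fin L → Bool × Bool)) :
    (crsfMeasure n m).real
        {σ | Function.Injective (Sum.elim (trajectory σ v L) (trajectory σ w L)) ∧
          (fun i => (σ (trajectory σ v L i), σ (trajectory σ w L i))) ∈ S} ≤ S.card / 4 ^ L := by
  let zip : (Fin L ⊕ Fin L → Bool) ≃ (Fin L → Bool × Bool) :=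
    (Equiv.sumArrowEquivProdArrow _ _ _).trans (Equiv.arrowProdEquivProdArrow _ _ _).symm
  have h := uniformOn_univ_real_explore_le
    ((isAdaptive_trajectory v L).sumElim (isAdaptive_trajectory w L))
    (S.map zip.symm.toEmbedding)
  rw [Finset.card_map, Fintype.card_sum, Fintype.card_fin, Fintype.card_bool, ← two_mul,
    pow_mul, Nat.cast_ofNat, show (2 : ℝ) ^ 2 = 4 by norm_num] at h
  simpa only [Finset.mem_map_equiv, Equiv.symm_symm] using! h

end Trajectory

/-! ### Binomial probabilities -/

/-- The probability that `a + b` fair coins show heads exactly `a` times, that is, that a simple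
north-east random walk passes through the point `(a, b)`. -/
noncomputable def binomialProb (a b : ℕ) : ℝ := (a + b).choose a / 2 ^ (a + b)

theorem card_filter_card_true_eq (L a : ℕ) :
    (Finset.univ.filter fun s : Fin L → Bool =>
      (Finset.univ.filter fun i => s i = true).card = a).card = L.choose a := by
  have hcard : (Finset.powersetCard a (Finset.univ : Finset (Fin L))).card = L.choose a := by
    rw [Finset.card_powersetCard, Finset.card_univ, Fintype.card_fin]
  rw [← hcard]
  exact Finset.card_nbij' (fun s => Finset.univ.filter fun i => s i = true)
    (fun t i => decide (i ∈ t)) (fun s hs => by simpa using hs)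
    (fun t ht => by simpa using ht) (fun s _ => by simp) (fun t _ => by simp)

theorem binomialProb_comm (a b : ℕ) : binomialProb a b = binomialProb b a := by
  rw [binomialProb, binomialProb, Nat.choose_symm_add, add_comm b a]

theorem binomialProb_succ_succ_self (a : ℕ) :
    binomialProb (a + 1) (a + 1) = (2 * a + 1) / (2 * (a + 1)) * binomialProb a a := by
  have h : ((a : ℝ) + 1) * (a + 1 + (a + 1)).choose (a + 1) =
      2 * (2 * a + 1) * (a + a).choose a := by
    rw [← two_mul, ← two_mul]
    exact_mod_cast Nat.succ_mul_centralBinom_succ a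
  rw [binomialProb, binomialProb]
  rw [show a + 1 + (a + 1) = a + a + 2 by ring] at h ⊢
  rw [pow_add]
  field_simp
  linear_combination h

theorem binomialProb_self_le (a : ℕ) : binomialProb a a ≤ 1 / √(2 * a + 1) := by
  have hsq : binomialProb a a ^ 2 * (2 * a + 1) ≤ 1 := by
    induction a with
    | zero => simp [binomialProb]
    | succ a ih =>
      refine le_trans ?_ ih
      have hfactor : (((2 * a + 1) / (2 * (a + 1))) ^ 2 * (2 * (a + 1) + 1) : ℝ) ≤ 2 * a + 1 := by
        rw [div_pow, div_mul_eq_mul_div, div_le_iff₀ (by positivity)]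
        nlinarith
      rw [binomialProb_succ_succ_self, mul_pow, mul_right_comm, mul_comm, Nat.cast_succ]
      gcongr
  rw [le_div_iff₀ (by positivity)]
  refine le_of_sq_le_sq ?_ (by norm_num)
  rwa [mul_pow, Real.sq_sqrt (by positivity), one_pow]

theorem binomialProb_succ_right (a b : ℕ) :
    binomialProb a (b + 1) = binomialProb a b * (1 - (b + 1 - a) / (2 * (b + 1))) := by
  have h : ((a + b).choose a : ℝ) * (a + b + 1) = (a + (b + 1)).choose a * (b + 1) := by
    have := Nat.choose_mul_succ_eq (a + b) a
    rw [add_assoc, add_tsub_cancel_left] at this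
    exact_mod_cast this
  rw [binomialProb, binomialProb, ← add_assoc, pow_succ]
  rw [← add_assoc] at h
  field_simp
  linear_combination -h

/-- The exponent `(b - a) (b - a + 1)`, slightly more than the square, is what makes the induction
on `b` close. -/
theorem binomialProb_le_of_le {a b B : ℕ} (hab : a ≤ b) (hB : b ≤ B) :
    binomialProb a b ≤
      1 / √(2 * a + 1) * Real.exp (-(((b : ℝ) - a) * (b - a + 1) / (4 * B))) := by
  induction b, hab using Nat.le_induction with
  | base => simpa using binomialProb_self_le a
  | succ b hab ih =>
    have hB0 : (0 : ℝ) < B := by exact_mod_cast b.succ_pos.trans_le hB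
    have hba : (a : ℝ) ≤ b := by exact_mod_cast hab
    have hbB : (b : ℝ) + 1 ≤ B := by exact_mod_cast hB
    have hratio : (1 : ℝ) - (b + 1 - a) / (2 * (b + 1)) ≤ Real.exp (-((b + 1 - a) / (2 * B))) := by
      refine le_trans ?_ (Real.one_sub_le_exp_neg _)
      gcongr
      linarith
    calc binomialProb a (b + 1)
        = binomialProb a b * (1 - (b + 1 - a) / (2 * (b + 1))) := binomialProb_succ_right a b
      _ ≤ 1 / √(2 * a + 1) * Real.exp (-(((b : ℝ) - a) * (b - a + 1) / (4 * B))) *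
            Real.exp (-((b + 1 - a) / (2 * B))) :=
          mul_le_mul (ih (b.le_succ.trans hB)) hratio
            (by rw [sub_nonneg, div_le_one (by positivity)]; linarith) (by positivity)
      _ = 1 / √(2 * a + 1) *
            Real.exp (-((((b + 1 : ℕ) : ℝ) - a) * (((b + 1 : ℕ) : ℝ) - a + 1) / (4 * B))) := by
          rw [mul_assoc, ← Real.exp_add]
          congr 2
          push_cast
          field_simp
          ring

theorem binomialProb_le (a b : ℕ) :
    binomialProb a b ≤
      1 / √(2 * min (a : ℝ) b + 1) * Real.exp (-(((a : ℝ) - b) ^ 2 / (4 * max (a : ℝ) b))) := by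
  wlog hab : a ≤ b generalizing a b
  · have := this b a (le_of_not_ge hab)
    rwa [binomialProb_comm, min_comm, max_comm, ← sub_sq_comm]
  have hab' : (a : ℝ) ≤ b := by exact_mod_cast hab
  rw [min_eq_left hab', max_eq_right hab']
  refine (binomialProb_le_of_le hab le_rfl).trans ?_
  gcongr
  nlinarith

theorem binomialProb_le_exp (a b : ℕ) :
    binomialProb a b ≤ Real.exp (-(((a : ℝ) - b) ^ 2 / (4 * max (a : ℝ) b))) := by
  refine (binomialProb_le a b).trans (mul_le_of_le_one_left (Real.exp_pos _).le ?_)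
  rw [div_le_one (by positivity), Real.one_le_sqrt, le_add_iff_nonneg_left]
  positivity

/-! ### Positive walks of small area -/

section NarrowWalk

variable {β : Type*}

/-- The walk started at `g` whose increments are the values of `ξ` along the string `s` stays
positive, and the area `∑ t < L` of its positions is at most `A`. -/
def IsNarrowWalk (ξ : β → ℤ) : (L : ℕ) → (Fin L → β) → ℤ → ℤ → Prop
  | 0, _, g, A => 1 ≤ g ∧ 0 ≤ A
  | L + 1, s, g, A => 1 ≤ g ∧ IsNarrowWalk ξ L (Fin.tail s) (g + ξ (s 0)) (A - g)

theorem IsNarrowWalk.of_positions {ξ : β → ℤ} {L : ℕ} {s : Fin L → β} {γ : ℕ → ℤ} {A : ℤ}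
    (hγ : ∀ t : Fin L, γ (t + 1) = γ t + ξ (s t)) (hpos : ∀ t ≤ L, 1 ≤ γ t)
    (harea : ∑ t ∈ Finset.range L, γ t ≤ A) : IsNarrowWalk ξ L s (γ 0) A := by
  induction L generalizing γ A with
  | zero => exact ⟨hpos 0 le_rfl, by simpa using harea⟩
  | succ L ih =>
    rw [Finset.sum_range_succ'] at harea
    refine ⟨hpos 0 L.succ.zero_le, ?_⟩
    have h := ih (s := Fin.tail s) (γ := fun t => γ (t + 1)) (A := A - γ 0) (fun t => hγ t.succ)
      (fun t ht => hpos (t + 1) (Nat.succ_le_succ ht)) (le_sub_iff_add_le.mpr harea)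
    rwa [show γ (0 + 1) = γ 0 + ξ (s 0) from hγ 0] at h

open Classical in
theorem card_isNarrowWalk_succ [Fintype β] (ξ : β → ℤ) (L : ℕ) {g : ℤ} (hg : 1 ≤ g) (A : ℤ) :
    (Finset.univ.filter fun s : Fin (L + 1) → β => IsNarrowWalk ξ (L + 1) s g A).card =
      ∑ b, (Finset.univ.filter fun s : Fin L → β => IsNarrowWalk ξ L s (g + ξ b) (A - g)).card := by
  simp only [Finset.card_filter]
  rw [← Equiv.sum_comp (Fin.consEquiv fun _ => β), Fintype.sum_prod_type]
  simp [Fin.consEquiv, IsNarrowWalk, hg]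

open Classical in
/-- A positive supersolution `ψ` of the walk killed at `0`, and discounted by `exp (-μ * position)`
at each step, bounds the number of narrow walks. -/
theorem card_isNarrowWalk_le [Fintype β] {ξ : β → ℤ} (hξ : ∀ b, -1 ≤ ξ b) {ψ : ℤ → ℝ} {μ K : ℝ}
    (hμ : 0 ≤ μ) (hK : 0 ≤ K) (hψ₀ : 0 ≤ ψ 0) (hψ₁ : ∀ g, 1 ≤ g → 1 ≤ ψ g)
    (hstep : ∀ g : ℤ, 1 ≤ g → Real.exp (-(μ * g)) * ∑ b, ψ (g + ξ b) ≤ K * ψ g)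
    (L : ℕ) {g : ℤ} (hg : 0 ≤ g) (A : ℤ) :
    ((Finset.univ.filter fun s : Fin L → β => IsNarrowWalk ξ L s g A).card : ℝ) ≤
      Real.exp (μ * A) * K ^ L * ψ g := by
  have hψ {g : ℤ} (hg : 0 ≤ g) : 0 ≤ ψ g := by
    obtain rfl | hg := hg.eq_or_lt
    exacts [hψ₀, zero_le_one.trans (hψ₁ g hg)]
  induction L generalizing g A with
  | zero =>
    by_cases h : 1 ≤ g ∧ 0 ≤ A
    · have hA : (0 : ℝ) ≤ A := by exact_mod_cast h.2
      simp only [IsNarrowWalk, h, and_self, Finset.filter_true, Finset.card_univ,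
        Fintype.card_unique, Nat.cast_one, pow_zero, mul_one]
      exact one_le_mul_of_one_le_of_one_le (Real.one_le_exp (by positivity)) (hψ₁ g h.1)
    · simp only [IsNarrowWalk, h, Finset.filter_false, Finset.card_empty, Nat.cast_zero]
      have := hψ hg
      positivity
  | succ L ih =>
    by_cases h : 1 ≤ g
    · rw [card_isNarrowWalk_succ ξ L h, Nat.cast_sum]
      calc _ ≤ ∑ b, Real.exp (μ * (A - g : ℤ)) * K ^ L * ψ (g + ξ b) :=
            Finset.sum_le_sum fun b _ => ih (by linarith [hξ b]) _
        _ = Real.exp (μ * A) * K ^ L * (Real.exp (-(μ * g)) * ∑ b, ψ (g + ξ b)) := by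
            rw [← Finset.mul_sum, Int.cast_sub, mul_sub, sub_eq_add_neg, Real.exp_add]
            ring
        _ ≤ Real.exp (μ * A) * K ^ L * (K * ψ g) :=
            mul_le_mul_of_nonneg_left (hstep g h) (by positivity)
        _ = Real.exp (μ * A) * K ^ (L + 1) * ψ g := by ring
    · simp only [IsNarrowWalk, h, false_and, Finset.filter_false, Finset.card_empty,
        Nat.cast_zero]
      have := hψ hg
      positivity

end NarrowWalk

/-- The change of the gap between two antidiagonally displaced walkers that read the bits `b.1`
and `b.2`, where `true` is a step to the east. -/
def gapStep (b : Bool × Bool) : ℤ := b.2.toNat - b.1.toNat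

theorem neg_one_le_gapStep (b : Bool × Bool) : -1 ≤ gapStep b := by
  revert b
  decide

theorem gapStep_le_one (b : Bool × Bool) : gapStep b ≤ 1 := by
  revert b
  decide

theorem gapStep_sub_gapStep_le_one (b c d : Bool) : gapStep (b, c) - gapStep (b, d) ≤ 1 := by
  revert b c d
  decide

theorem sum_gapStep (f : ℤ → ℝ) (g : ℤ) :
    ∑ b, f (g + gapStep b) = f (g + 1) + f (g - 1) + 2 * f g := by
  simp only [Fintype.sum_prod_type, Fintype.sum_bool, gapStep, Bool.toNat_true, Bool.toNat_false,
    Nat.cast_one, Nat.cast_zero, sub_self, add_zero, zero_sub, sub_zero, ← sub_eq_add_neg]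
  ring

/-- The potential that makes a walk confined below height `R` lose a fixed fraction of its mass
every `R ^ 2` steps: concave with second difference `-2 / R ^ 2` below `R`, and constant above,
where the walk is instead killed by the area it sweeps. -/
noncomputable def gapPotential (R : ℝ) (g : ℤ) : ℝ := 2 - max (1 - g / R) 0 ^ 2

theorem gapPotential_le_two (R : ℝ) (g : ℤ) : gapPotential R g ≤ 2 := by
  rw [gapPotential, sub_le_self_iff]
  positivity

theorem one_le_gapPotential {R : ℝ} (hR : 0 < R) {g : ℤ} (hg : 0 ≤ g) : 1 ≤ gapPotential R g := by
  have : (0 : ℝ) ≤ g := by exact_mod_cast hg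
  have h₁ : max (1 - g / R) 0 ≤ 1 := max_le (sub_le_self 1 (by positivity)) zero_le_one
  have := pow_le_one₀ (n := 2) (le_max_right (1 - g / R) 0) h₁
  rw [gapPotential]
  linarith

theorem sum_gapPotential_le {R : ℝ} (hR : 0 < R) {g : ℤ} (hg : g ≤ R) :
    ∑ b, gapPotential R (g + gapStep b) ≤ 4 * gapPotential R g - 1 / R ^ 2 := by
  have hx : 0 ≤ 1 - g / R := sub_nonneg.mpr ((div_le_one hR).mpr hg)
  have hh : 0 < 1 / R := by positivity
  rw [sum_gapStep, gapPotential, gapPotential, gapPotential, max_eq_left hx,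
    show 1 - ((g + 1 : ℤ) : ℝ) / R = 1 - g / R - 1 / R by push_cast; ring,
    show 1 - ((g - 1 : ℤ) : ℝ) / R = 1 - g / R + 1 / R by push_cast; ring, ← one_div_pow]
  generalize 1 - g / R = x, 1 / R = h at hx hh ⊢
  rw [max_eq_left (by positivity : 0 ≤ x + h)]
  rcases le_total h x with hxh | hxh
  · rw [max_eq_left (sub_nonneg.mpr hxh)]
    nlinarith
  · rw [max_eq_right (sub_nonpos.mpr hxh)]
    nlinarith

theorem exp_mul_sum_gapPotential_le {R : ℝ} (hR : 0 < R) {g : ℤ} (hg : 0 ≤ g) :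
    Real.exp (-(1 / (8 * R ^ 3) * g)) * ∑ b, gapPotential R (g + gapStep b) ≤
      4 * Real.exp (-(1 / (8 * R ^ 2))) * gapPotential R g := by
  have : (0 : ℝ) ≤ g := by exact_mod_cast hg
  have hψ := one_le_gapPotential hR hg
  rcases le_total R g with h | h
  · have hconst : gapPotential R g = 2 := by
      rw [gapPotential, max_eq_right (sub_nonpos.mpr ((one_le_div hR).mpr h))]
      norm_num
    have hsum : ∑ b, gapPotential R (g + gapStep b) ≤ 8 := by
      rw [sum_gapStep]
      linarith [gapPotential_le_two R (g + 1), gapPotential_le_two R (g - 1)]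
    have hkill : 1 / (8 * R ^ 2) ≤ 1 / (8 * R ^ 3) * g := by
      calc 1 / (8 * R ^ 2) = 1 / (8 * R ^ 3) * R := by field_simp
        _ ≤ 1 / (8 * R ^ 3) * g := by gcongr
    calc Real.exp (-(1 / (8 * R ^ 3) * g)) * ∑ b, gapPotential R (g + gapStep b)
        ≤ Real.exp (-(1 / (8 * R ^ 3) * g)) * 8 := by gcongr
      _ ≤ Real.exp (-(1 / (8 * R ^ 2))) * 8 := by gcongr
      _ = 4 * Real.exp (-(1 / (8 * R ^ 2))) * gapPotential R g := by rw [hconst]; ring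
  · have hdecay := Real.one_sub_le_exp_neg (1 / (8 * R ^ 2))
    have hsum : ∑ b, gapPotential R (g + gapStep b) ≤
        4 * Real.exp (-(1 / (8 * R ^ 2))) * gapPotential R g := by
      calc ∑ b, gapPotential R (g + gapStep b)
          ≤ 4 * gapPotential R g - 1 / R ^ 2 := sum_gapPotential_le hR h
        _ = 4 * gapPotential R g - 4 * (1 / (8 * R ^ 2)) * 2 := by ring
        _ ≤ 4 * gapPotential R g - 4 * (1 / (8 * R ^ 2)) * gapPotential R g := by
            gcongr
            exact gapPotential_le_two R g
        _ = 4 * (1 - 1 / (8 * R ^ 2)) * gapPotential R g := by ring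
        _ ≤ 4 * Real.exp (-(1 / (8 * R ^ 2))) * gapPotential R g := by gcongr
    have hexp : Real.exp (-(1 / (8 * R ^ 3) * g)) ≤ 1 := by
      rw [Real.exp_le_one_iff, neg_nonpos]
      positivity
    exact (mul_le_mul_of_nonneg_left hsum (Real.exp_pos _).le).trans
      (mul_le_of_le_one_left (by positivity) hexp)

open Classical in
theorem card_isNarrowWalk_gapStep_le {R : ℝ} (hR : 0 < R) {L : ℕ} {g : ℤ} (hg : 0 ≤ g) {A : ℤ}
    (hA : 2 * A ≤ L * R) :
    ((Finset.univ.filter fun s => IsNarrowWalk gapStep L s g A).card : ℝ) / 4 ^ L ≤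
      2 * Real.exp (-(L / (16 * R ^ 2))) := by
  have hcount := card_isNarrowWalk_le neg_one_le_gapStep (by positivity) (by positivity)
    (zero_le_one.trans (one_le_gapPotential hR le_rfl))
    (fun g hg => one_le_gapPotential hR (by lia))
    (fun g hg => exp_mul_sum_gapPotential_le hR (by lia)) L hg A
  have hexponent : 1 / (8 * R ^ 3) * A + L * -(1 / (8 * R ^ 2)) ≤ -(L / (16 * R ^ 2)) := by
    calc 1 / (8 * R ^ 3) * A + L * -(1 / (8 * R ^ 2))
        = 1 / (16 * R ^ 3) * (2 * A) - L / (8 * R ^ 2) := by ring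
      _ ≤ 1 / (16 * R ^ 3) * (L * R) - L / (8 * R ^ 2) := by gcongr
      _ = -(L / (16 * R ^ 2)) := by field_simp; ring
  have hψ : 0 ≤ gapPotential R g := zero_le_one.trans (one_le_gapPotential hR hg)
  rw [div_le_iff₀ (by positivity)]
  calc _ ≤ Real.exp (1 / (8 * R ^ 3) * A) * (4 * Real.exp (-(1 / (8 * R ^ 2)))) ^ L *
        gapPotential R g := hcount
    _ = Real.exp (1 / (8 * R ^ 3) * A + L * -(1 / (8 * R ^ 2))) * 4 ^ L * gapPotential R g := by
        rw [mul_pow, ← Real.exp_nat_mul, Real.exp_add]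
        ring
    _ ≤ Real.exp (-(L / (16 * R ^ 2))) * 4 ^ L * 2 := by
        gcongr
        exact gapPotential_le_two R g
    _ = 2 * Real.exp (-(L / (16 * R ^ 2))) * 4 ^ L := by ring

/-! ### Orbits and antidiagonal gaps -/

section Dynamics

variable {n m : ℕ}

/-- The number of steps to the east among the first `t` steps of the orbit of `v`. -/
def eastCount (σ : Forest n m) (v : Torus n m) (t : ℕ) : ℕ :=
  Nat.count (fun i => σ ((next σ)^[i] v)) t

/-- The number of steps to the north among the first `t` steps of the orbit of `v`. -/
def northCount (σ : Forest n m) (v : Torus n m) (t : ℕ) : ℕ :=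
  Nat.count (fun i => ¬σ ((next σ)^[i] v)) t

theorem eastCount_add_northCount (σ : Forest n m) (v : Torus n m) (t : ℕ) :
    eastCount σ v t + northCount σ v t = t := by
  induction t with
  | zero => rfl
  | succ t ih =>
    rw [eastCount, northCount] at ih ⊢
    rw [Nat.count_succ, Nat.count_succ]
    split_ifs <;> omega

theorem iterate_next_eq (σ : Forest n m) (v : Torus n m) (t : ℕ) :
    (next σ)^[t] v = (v.1 + (eastCount σ v t : ZMod n), v.2 + (northCount σ v t : ZMod m)) := by
  induction t with
  | zero => simp [eastCount, northCount]
  | succ t ih =>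
    rw [Function.iterate_succ_apply', next, eastCount, northCount, Nat.count_succ, Nat.count_succ,
      ← eastCount, ← northCount]
    by_cases h : σ ((next σ)^[t] v)
    · rw [if_pos h, if_pos h, if_neg (not_not.mpr h), ih]
      simp [add_assoc]
    · rw [if_neg h, if_neg h, if_pos h, ih]
      simp [add_assoc]

theorem card_filter_trajectory_eq_eastCount (σ : Forest n m) (v : Torus n m) (L : ℕ) :
    (Finset.univ.filter fun i => (σ ∘ trajectory σ v L) i = true).card = eastCount σ v L := by
  rw [eastCount, Nat.count_eq_card_filter_range, Finset.card_filter, Finset.card_filter,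
    Finset.sum_range]
  rfl

theorem dvd_eastCount_of_isPeriodicPt {σ : Forest n m} {v : Torus n m} {L : ℕ}
    (h : Function.IsPeriodicPt (next σ) L v) : n ∣ eastCount σ v L := by
  have hfst := congrArg Prod.fst ((iterate_next_eq σ v L).symm.trans h)
  exact (ZMod.natCast_eq_zero_iff _ _).mp (add_eq_left.mp hfst)

theorem dvd_northCount_of_isPeriodicPt {σ : Forest n m} {v : Torus n m} {L : ℕ}
    (h : Function.IsPeriodicPt (next σ) L v) : m ∣ northCount σ v L := by
  have hsnd := congrArg Prod.snd ((iterate_next_eq σ v L).symm.trans h)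
  exact (ZMod.natCast_eq_zero_iff _ _).mp (add_eq_left.mp hsnd)

theorem exists_eastCount_eq {σ : Forest n m} {v : Torus n m} {k t : ℕ}
    (hk : k ≤ eastCount σ v t) : ∃ s, eastCount σ v s = k := by
  induction t with
  | zero => exact ⟨0, (Nat.le_zero.mp hk).symm⟩
  | succ t ih =>
    rcases hk.eq_or_lt with heq | hlt
    · exact ⟨t + 1, heq.symm⟩
    · rw [eastCount, Nat.count_succ, ← eastCount] at hlt
      exact ih (by split_ifs at hlt <;> omega)

theorem exists_iterate_fst_eq_zero [NeZero n] {σ : Forest n m} {v : Torus n m} {L : ℕ}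
    (h : Function.IsPeriodicPt (next σ) L v) (h₀ : eastCount σ v L ≠ 0) :
    ∃ t, ((next σ)^[t] v).1 = 0 := by
  have hn : n ≤ eastCount σ v L :=
    Nat.le_of_dvd (Nat.pos_of_ne_zero h₀) (dvd_eastCount_of_isPeriodicPt h)
  obtain ⟨t, ht⟩ := exists_eastCount_eq ((Nat.sub_le n v.1.val).trans hn)
  refine ⟨t, ?_⟩
  rw [iterate_next_eq, ht, Nat.cast_sub (ZMod.val_lt _).le]
  simp

/-- The vertex `g` steps further to the south-east along the antidiagonal of `v`. -/
def shift (v : Torus n m) (g : ℤ) : Torus n m := (v.1 + g, v.2 - g)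

theorem shift_shift (v : Torus n m) (g h : ℤ) : shift (shift v g) h = shift v (g + h) := by
  simp [shift, add_assoc, sub_sub]

theorem shift_zero (v : Torus n m) : shift v 0 = v := by simp [shift]

theorem exists_pos_shift_eq [NeZero n] [NeZero m] (v : Torus n m) (g : ℤ) :
    ∃ j : ℕ, 0 < j ∧ shift v j = shift v g := by
  have hnm : (0 : ℤ) < n * m := by exact_mod_cast Nat.mul_pos (NeZero.pos n) (NeZero.pos m)
  have hpos : 0 < g % (n * m) + n * m := by linarith [Int.emod_nonneg g hnm.ne']
  refine ⟨(g % (n * m) + n * m).toNat, by lia, ?_⟩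
  rw [Int.toNat_of_nonneg hpos.le, Int.emod_def]
  simp [shift]

theorem exists_shift_eq_iterate [NeZero n] [NeZero m] (σ : Forest n m) (v w : Torus n m) :
    ∃ (t : ℕ) (g : ℤ), shift v g = (next σ)^[t] w := by
  set a := (v.1 - w.1).val
  set b := (v.2 - w.2).val
  have ha' : (a : ZMod n) = v.1 - w.1 := ZMod.natCast_zmod_val _
  have hb' : (b : ZMod m) = v.2 - w.2 := ZMod.natCast_zmod_val _
  have hsum : (eastCount σ w (a + b) + northCount σ w (a + b) : ZMod m) = a + b := by
    exact_mod_cast congrArg (Nat.cast (R := ZMod m)) (eastCount_add_northCount σ w (a + b))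
  refine ⟨a + b, eastCount σ w (a + b) - a, ?_⟩
  rw [iterate_next_eq, shift]
  push_cast
  ext
  · linear_combination -ha'
  · linear_combination -hsum - hb'

theorem next_eq_shift_next_iff {σ : Forest n m} {u v : Torus n m} {i : ℤ} :
    next σ u = shift (next σ v) (i + gapStep (σ v, σ u)) ↔ u = shift v i := by
  rcases hv : σ v with _ | _ <;> rcases hu : σ u with _ | _ <;>
    simp only [next, hv, hu, gapStep, shift, Prod.ext_iff, if_true, Bool.false_eq_true, if_false,
      Bool.toNat_true, Bool.toNat_false] <;> push_cast <;>
    refine and_congr ?_ ?_ <;> constructor <;> intro h <;> linear_combination h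

/-- The gap, after `t` steps, between the orbits of `v` and `shift v g`. It is an integer: winding
around the torus is not reduced. -/
def gapAt (σ : Forest n m) (v : Torus n m) (g : ℤ) (t : ℕ) : ℤ :=
  g + ∑ i ∈ Finset.range t, gapStep (σ ((next σ)^[i] v), σ ((next σ)^[i] (shift v g)))

theorem gapAt_zero (σ : Forest n m) (v : Torus n m) (g : ℤ) : gapAt σ v g 0 = g := by
  simp [gapAt]

theorem gapAt_succ (σ : Forest n m) (v : Torus n m) (g : ℤ) (t : ℕ) :
    gapAt σ v g (t + 1) =
      gapAt σ v g t + gapStep (σ ((next σ)^[t] v), σ ((next σ)^[t] (shift v g))) := by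
  rw [gapAt, Finset.sum_range_succ, ← add_assoc, gapAt]

theorem iterate_next_shift (σ : Forest n m) (v : Torus n m) (g : ℤ) (t : ℕ) :
    (next σ)^[t] (shift v g) = shift ((next σ)^[t] v) (gapAt σ v g t) := by
  induction t with
  | zero => rw [gapAt_zero, Function.iterate_zero_apply, Function.iterate_zero_apply]
  | succ t ih =>
    rw [Function.iterate_succ_apply', Function.iterate_succ_apply', gapAt_succ]
    exact next_eq_shift_next_iff.mpr ih

/-- `shift v g` is the first vertex of `C` after `v ∈ C` along the antidiagonal. -/
def IsGap (C : Set (Torus n m)) (v : Torus n m) (g : ℤ) : Prop :=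
  1 ≤ g ∧ v ∈ C ∧ shift v g ∈ C ∧ ∀ i, 0 < i → i < g → shift v i ∉ C

theorem IsGap.next {σ : Forest n m} {C : Set (Torus n m)} (hC : Set.BijOn (next σ) C C)
    {v : Torus n m} {g : ℤ} (h : IsGap C v g) (hne : CRSF.next σ (shift v g) ≠ CRSF.next σ v) :
    IsGap C (CRSF.next σ v) (g + gapStep (σ v, σ (shift v g))) := by
  obtain ⟨hg, hv, hw, hbetween⟩ := h
  have hnext : CRSF.next σ (shift v g) = shift (CRSF.next σ v) (g + gapStep (σ v, σ (shift v g))) :=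
    next_eq_shift_next_iff.mpr rfl
  have hstep := neg_one_le_gapStep (σ v, σ (shift v g))
  refine ⟨?_, hC.mapsTo hv, hnext ▸ hC.mapsTo hw, fun i hi hig hmem => ?_⟩
  · have hne₀ : g + gapStep (σ v, σ (shift v g)) ≠ 0 := by
      intro h₀
      rw [h₀, shift_zero] at hnext
      exact hne hnext
    omega
  · obtain ⟨u, hu, hui⟩ := hC.surjOn hmem
    set j := i - gapStep (σ v, σ u) with hj
    have hij : i = j + gapStep (σ v, σ u) := (sub_add_cancel _ _).symm
    rw [hij, next_eq_shift_next_iff] at hui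
    have hj₀ : 0 ≤ j := by
      have := gapStep_le_one (σ v, σ u)
      omega
    have hjg : j ≤ g := by
      have := gapStep_sub_gapStep_le_one (σ v) (σ (shift v g)) (σ u)
      omega
    rcases hj₀.eq_or_lt with hj₀ | hj₀
    · rw [← hj₀, shift_zero] at hui
      rw [← hj₀, hui, gapStep, sub_self] at hij
      exact hi.ne' hij
    rcases hjg.eq_or_lt with hjg | hjg
    · rw [hij, hui, hjg] at hig
      exact hig.false
    · exact hbetween j hj₀ hjg (hui ▸ hu)

theorem IsGap.iterate {σ : Forest n m} {C : Set (Torus n m)} (hC : Set.BijOn (CRSF.next σ) C C)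
    {v : Torus n m} {g : ℤ} (h : IsGap C v g)
    (hne : ∀ t, (CRSF.next σ)^[t] (shift v g) ≠ (CRSF.next σ)^[t] v) (t : ℕ) :
    IsGap C ((CRSF.next σ)^[t] v) (gapAt σ v g t) := by
  induction t with
  | zero => rwa [gapAt_zero]
  | succ t ih =>
    have hne' := hne (t + 1)
    rw [Function.iterate_succ_apply', Function.iterate_succ_apply', iterate_next_shift] at hne'
    rw [Function.iterate_succ_apply', gapAt_succ, iterate_next_shift]
    exact ih.next hC hne'

theorem IsGap.eq_of_shift_eq {C : Set (Torus n m)} {u v : Torus n m} {g i j : ℤ}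
    (h : IsGap C v g) (hu : u ∈ C) (hi : 0 ≤ i) (hij : i ≤ j) (hj : j < g)
    (heq : shift u i = shift v j) : u = v ∧ i = j := by
  have huv : u = shift v (j - i) := by
    have := congrArg (shift · (-i)) heq
    simpa only [shift_shift, add_neg_cancel, shift_zero, ← sub_eq_add_neg] using this
  rcases hij.eq_or_lt with rfl | hlt
  · rw [sub_self, shift_zero] at huv
    exact ⟨huv, rfl⟩
  · exact absurd (huv ▸ hu) (h.2.2.2 (j - i) (by omega) (by omega))

/-- The antidiagonal arcs from the vertices `u t` to their successors in `C` are disjoint. -/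
theorem sum_gap_le [NeZero n] [NeZero m] {C : Set (Torus n m)} {ι : Type*} {s : Finset ι}
    {u : ι → Torus n m} (hu : Set.InjOn u s) {γ : ι → ℤ} (h : ∀ t ∈ s, IsGap C (u t) (γ t)) :
    ∑ t ∈ s, γ t ≤ n * m := by
  have hinj : Set.InjOn (fun p : Σ _ : ι, ℤ => shift (u p.1) p.2)
      (s.sigma fun t => Finset.Ico 0 (γ t)) := by
    rintro ⟨t, i⟩ hp ⟨t', i'⟩ hp' heq
    simp only [Finset.mem_coe, Finset.mem_sigma, Finset.mem_Ico] at hp hp'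
    obtain ⟨ht, hi₀, hi⟩ := hp
    obtain ⟨ht', hi₀', hi'⟩ := hp'
    have hvi : u t = u t' ∧ i = i' := by
      rcases le_total i i' with hle | hle
      · exact (h t' ht').eq_of_shift_eq (h t ht).2.1 hi₀ hle hi' heq
      · have := (h t ht).eq_of_shift_eq (h t' ht').2.1 hi₀' hle hi heq.symm
        exact ⟨this.1.symm, this.2.symm⟩
    rw [hu ht ht' hvi.1, hvi.2]
  have hcard := Finset.card_le_card_of_injOn (t := Finset.univ) _ (fun _ _ => Finset.mem_univ _)
    hinj
  rw [Finset.card_sigma, Finset.card_univ, Fintype.card_prod, ZMod.card, ZMod.card] at hcard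
  calc ∑ t ∈ s, γ t = ((∑ t ∈ s, (Finset.Ico 0 (γ t)).card : ℕ) : ℤ) := by
        rw [Nat.cast_sum]
        refine Finset.sum_congr rfl fun t ht => ?_
        rw [Int.card_Ico, sub_zero, Int.toNat_of_nonneg (zero_le_one.trans (h t ht).1)]
    _ ≤ n * m := by exact_mod_cast hcard

end Dynamics

section Cycles

variable {n m : ℕ}

theorem IsCycle.subset_periodicPts {σ : Forest n m} {c : Set (Torus n m)} (hc : IsCycle σ c) :
    c ⊆ Function.periodicPts (next σ) := by
  obtain ⟨v, hv, rfl⟩ := hc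
  rintro _ ⟨k, rfl⟩
  exact (Function.bijOn_periodicPts (next σ)).mapsTo.iterate k hv

theorem IsCycle.bijOn {σ : Forest n m} {c : Set (Torus n m)} (hc : IsCycle σ c) :
    Set.BijOn (next σ) c c := by
  refine ⟨?_, (Function.bijOn_periodicPts (next σ)).injOn.mono hc.subset_periodicPts, ?_⟩ <;>
    obtain ⟨v, ⟨p, hp, hper⟩, rfl⟩ := hc
  · rintro _ ⟨k, rfl⟩
    exact ⟨k + 1, Function.iterate_succ_apply' _ _ _⟩
  · rintro _ ⟨k, rfl⟩
    refine ⟨(next σ)^[k + (p - 1)] v, ⟨_, rfl⟩, ?_⟩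
    rw [← Function.iterate_succ_apply' (next σ), Nat.succ_eq_add_one, add_assoc,
      Nat.sub_add_cancel hp, Function.iterate_add_apply, hper.eq]

theorem injective_trajectory {σ : Forest n m} {v : Torus n m} {L : ℕ}
    (hL : L ≤ Function.minimalPeriod (next σ) v) : Function.Injective (trajectory σ v L) := by
  intro i j h
  exact Fin.ext (Function.iterate_injOn_Iio_minimalPeriod (i.isLt.trans_le hL)
    (j.isLt.trans_le hL) h)

theorem IsGap.le_mul [NeZero n] [NeZero m] {C : Set (Torus n m)} {v : Torus n m} {g : ℤ}
    (h : IsGap C v g) : g ≤ n * m := by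
  simpa using sum_gap_le (s := {()}) (u := fun _ => v) (γ := fun _ => g) (by simp) (by simpa)

theorem exists_isGap_union [NeZero n] [NeZero m] {σ : Forest n m} {c₁ c₂ : Set (Torus n m)}
    (hc₁ : IsCycle σ c₁) (hc₂ : IsCycle σ c₂) :
    ∃ v ∈ c₁, ∃ g : ℤ, shift v g ∈ c₂ ∧ IsGap (c₁ ∪ c₂) v g := by
  classical
  have hex : ∃ j : ℕ, 0 < j ∧ ∃ v ∈ c₁, shift v j ∈ c₂ := by
    obtain ⟨v, -, rfl⟩ := hc₁
    obtain ⟨w, -, rfl⟩ := hc₂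
    obtain ⟨t, g, hg⟩ := exists_shift_eq_iterate σ v w
    obtain ⟨j, hj, hjg⟩ := exists_pos_shift_eq v g
    exact ⟨j, hj, v, ⟨0, rfl⟩, t, (hjg.trans hg).symm⟩
  obtain ⟨hpos, v, hv, hw⟩ := Nat.find_spec hex
  refine ⟨v, hv, Nat.find hex, hw, by exact_mod_cast hpos, .inl hv, .inr hw, ?_⟩
  intro i hi hig hmem
  lift i to ℕ using hi.le
  norm_cast at hi hig
  rcases hmem with h₁ | h₂
  · refine Nat.find_min hex (Nat.sub_lt hpos hi) ⟨Nat.sub_pos_of_lt hig, _, h₁, ?_⟩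
    rwa [shift_shift, Nat.cast_sub hig.le, add_sub_cancel]
  · exact Nat.find_min hex hig ⟨hi, v, hv, h₂⟩

end Cycles

/-! ### The union bound -/

section UnionBound

variable {n m : ℕ}

/-- The orbit of `v` starts with `a + b` distinct vertices, at which `a` steps to the east and `b`
steps to the north are taken. -/
def pathEvent (v : Torus n m) (a b : ℕ) : Set (Forest n m) :=
  {σ | Function.Injective (trajectory σ v (a + b)) ∧ eastCount σ v (a + b) = a}

/-- The orbits of `v` and `shift v g` are simple and disjoint for `L` steps, and the gap between
them stays positive and has a sum of at most `n * m`. -/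
def gapEvent (v : Torus n m) (g : ℤ) (L : ℕ) : Set (Forest n m) :=
  {σ | Function.Injective (Sum.elim (trajectory σ v L) (trajectory σ (shift v g) L)) ∧
    IsNarrowWalk gapStep L
      (fun i => (σ (trajectory σ v L i), σ (trajectory σ (shift v g) L i))) g (n * m)}

theorem exists_mem_pathEvent [NeZero n] {σ : Forest n m} {v : Torus n m}
    (hv : v ∈ Function.periodicPts (next σ)) :
    ∃ (u : Torus n m) (i j : ℕ), σ ∈ pathEvent u (i * n) (j * m) ∧
      i * n + j * m = Function.minimalPeriod (next σ) v ∧ (i ≠ 0 → u.1 = 0) := by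
  suffices ∃ t, eastCount σ ((next σ)^[t] v) (Function.minimalPeriod (next σ) v) ≠ 0 →
      ((next σ)^[t] v).1 = 0 by
    obtain ⟨t, ht⟩ := this
    have hperiod := Function.minimalPeriod_apply_iterate hv t
    have hclosed := hperiod ▸ Function.isPeriodicPt_minimalPeriod (next σ) ((next σ)^[t] v)
    obtain ⟨i, hi⟩ := dvd_eastCount_of_isPeriodicPt hclosed
    obtain ⟨j, hj⟩ := dvd_northCount_of_isPeriodicPt hclosed
    have hsum := eastCount_add_northCount σ ((next σ)^[t] v) (Function.minimalPeriod (next σ) v)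
    rw [hi, hj, mul_comm n, mul_comm m] at hsum
    refine ⟨(next σ)^[t] v, i, j, ?_, hsum, fun h => ht ?_⟩
    · rw [pathEvent, hsum]
      exact ⟨injective_trajectory hperiod.ge, hi.trans (mul_comm n i)⟩
    · rw [hi]
      exact mul_ne_zero (NeZero.ne n) h
  by_cases h : eastCount σ v (Function.minimalPeriod (next σ) v) = 0
  · exact ⟨0, fun h' => absurd h h'⟩
  · obtain ⟨t, ht⟩ := exists_iterate_fst_eq_zero (Function.isPeriodicPt_minimalPeriod (next σ) v) h
    exact ⟨t, fun _ => ht⟩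

variable [NeZero n] [NeZero m]

theorem exists_mem_gapEvent {σ : Forest n m} {c₁ c₂ : Set (Torus n m)} (hc₁ : IsCycle σ c₁)
    (hc₂ : IsCycle σ c₂) (hdisj : Disjoint c₁ c₂) {L : ℕ}
    (h₁ : ∀ v ∈ c₁, L ≤ Function.minimalPeriod (next σ) v)
    (h₂ : ∀ v ∈ c₂, L ≤ Function.minimalPeriod (next σ) v) :
    ∃ (v : Torus n m) (g : ℤ), g ∈ Finset.Icc 1 (n * m : ℤ) ∧ σ ∈ gapEvent v g L := by
  obtain ⟨v, hv, g, hw, hgap⟩ := exists_isGap_union hc₁ hc₂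
  have hv' (t : ℕ) : (next σ)^[t] v ∈ c₁ := hc₁.bijOn.mapsTo.iterate t hv
  have hw' (t : ℕ) : (next σ)^[t] (shift v g) ∈ c₂ := hc₂.bijOn.mapsTo.iterate t hw
  have hne (s t : ℕ) : (next σ)^[s] v ≠ (next σ)^[t] (shift v g) :=
    fun h => hdisj.notMem_of_mem_left (hv' s) (h ▸ hw' t)
  have hbij : Set.BijOn (next σ) (c₁ ∪ c₂) (c₁ ∪ c₂) := by
    refine hc₁.bijOn.union hc₂.bijOn ?_
    refine (Function.bijOn_periodicPts (next σ)).injOn.mono ?_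
    exact Set.union_subset hc₁.subset_periodicPts hc₂.subset_periodicPts
  have hgaps := hgap.iterate hbij fun t => (hne t t).symm
  refine ⟨v, g, Finset.mem_Icc.mpr ⟨hgap.1, hgap.le_mul⟩, ?_, ?_⟩
  · exact (injective_trajectory (h₁ v hv)).sumElim (injective_trajectory (h₂ _ hw))
      fun s t => hne s t
  · have hwalk : IsNarrowWalk gapStep L
        (fun i => (σ (trajectory σ v L i), σ (trajectory σ (shift v g) L i)))
        (gapAt σ v g 0) (n * m) := by
      refine .of_positions (fun t => gapAt_succ σ v g t) (fun t _ => (hgaps t).1) ?_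
      refine sum_gap_le (Function.iterate_injOn_Iio_minimalPeriod.mono fun t ht => ?_)
        fun t _ => hgaps t
      exact (Finset.mem_range.mp ht).trans_le (h₁ v hv)
    rwa [gapAt_zero] at hwalk

theorem crsfMeasure_real_pathEvent_le (v : Torus n m) (a b : ℕ) :
    (crsfMeasure n m).real (pathEvent v a b) ≤ binomialProb a b := by
  have h := crsfMeasure_real_trajectory_le v (a + b) (Finset.univ.filter fun s =>
    (Finset.univ.filter fun i => s i = true).card = a)
  rw [card_filter_card_true_eq] at h
  simpa only [Finset.mem_filter, Finset.mem_univ, true_and, card_filter_trajectory_eq_eastCount]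
    using! h

theorem crsfMeasure_real_gapEvent_le (v : Torus n m) {g : ℤ} (hg : 0 ≤ g) {L : ℕ} {R : ℝ}
    (hR : 0 < R) (hL : 2 * (n * m) ≤ L * R) :
    (crsfMeasure n m).real (gapEvent v g L) ≤ 2 * Real.exp (-(L / (16 * R ^ 2))) := by
  classical
  have h := crsfMeasure_real_trajectory_pair_le v (shift v g) L
    (Finset.univ.filter fun s => IsNarrowWalk gapStep L s g (n * m))
  simp only [Finset.mem_filter, Finset.mem_univ, true_and] at h
  exact h.trans (card_isNarrowWalk_gapStep_le hR hg (by exact_mod_cast hL))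

/-- Some vertex of the column `x = 0` starts a path which winds equally often, and less than `L`
times, around the torus in both directions. -/
def diagonalEvent (n m : ℕ) [NeZero m] (L : ℕ) : Set (Forest n m) :=
  ⋃ p ∈ (Finset.univ ×ˢ Finset.range L : Finset (ZMod m × ℕ)),
    pathEvent (0, p.1) ((p.2 + 1) * n) ((p.2 + 1) * m)

/-- Some vertex starts a path of length less than `L` which winds `i` times around the torus to the
east and `j ≠ i` times to the north. -/
def offDiagonalEvent (n m : ℕ) [NeZero n] [NeZero m] (L : ℕ) : Set (Forest n m) :=
  ⋃ p ∈ (Finset.univ : Finset (Torus n m)) ×ˢ ((Finset.range L ×ˢ Finset.range L).filter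
    fun q => q.1 ≠ q.2 ∧ q.1 * n + q.2 * m < L), pathEvent p.1 (p.2.1 * n) (p.2.2 * m)

/-- Some two orbits stay adjacent and disjoint for `L` steps. -/
def longEvent (n m : ℕ) [NeZero n] [NeZero m] (L : ℕ) : Set (Forest n m) :=
  ⋃ p ∈ (Finset.univ : Finset (Torus n m)) ×ˢ Finset.Icc 1 (n * m : ℤ), gapEvent p.1 p.2 L

theorem IsCycle.mem_diagonalEvent_or_mem_offDiagonalEvent {σ : Forest n m} {c : Set (Torus n m)}
    (hc : IsCycle σ c) {v : Torus n m} (hv : v ∈ c) {L : ℕ}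
    (hL : Function.minimalPeriod (next σ) v < L) :
    σ ∈ diagonalEvent n m L ∨ σ ∈ offDiagonalEvent n m L := by
  have hper := hc.subset_periodicPts hv
  obtain ⟨⟨x, y⟩, i, j, hmem, hij, hx⟩ := exists_mem_pathEvent hper
  have hi : i < L := by have := Nat.le_mul_of_pos_right i (NeZero.pos n); omega
  have hj : j < L := by have := Nat.le_mul_of_pos_right j (NeZero.pos m); omega
  by_cases heq : i = j
  · subst heq
    have hi₀ : i ≠ 0 := by
      rintro rfl
      exact (Function.minimalPeriod_pos_of_mem_periodicPts hper).ne' (by simpa using hij.symm)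
    obtain rfl : x = 0 := hx hi₀
    obtain ⟨k, rfl⟩ := Nat.exists_eq_succ_of_ne_zero hi₀
    exact .inl (Set.mem_biUnion (x := (y, k)) (by simpa using k.le_succ.trans_lt hi) hmem)
  · exact .inr (Set.mem_biUnion (x := ((x, y), (i, j))) (by simp [hi, hj, heq, hij ▸ hL]) hmem)

theorem twoDisjointCycles_subset (L : ℕ) :
    twoDisjointCycles n m ⊆ diagonalEvent n m L ∪ offDiagonalEvent n m L ∪ longEvent n m L := by
  rintro σ ⟨c₁, c₂, hc₁, hc₂, hdisj⟩
  by_cases hshort : ∃ c, IsCycle σ c ∧ ∃ v ∈ c, Function.minimalPeriod (next σ) v < L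
  · obtain ⟨c, hc, v, hv, hL⟩ := hshort
    exact .inl (hc.mem_diagonalEvent_or_mem_offDiagonalEvent hv hL)
  · push Not at hshort
    obtain ⟨v, g, hg, hmem⟩ := exists_mem_gapEvent hc₁ hc₂ hdisj (hshort c₁ hc₁) (hshort c₂ hc₂)
    exact .inr (Set.mem_biUnion (x := (v, g)) (by simpa using hg) hmem)

theorem crsfMeasure_real_diagonalEvent_le (L : ℕ) :
    (crsfMeasure n m).real (diagonalEvent n m L) ≤
      m * ∑ k ∈ Finset.range L, binomialProb ((k + 1) * n) ((k + 1) * m) :=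
  calc (crsfMeasure n m).real (diagonalEvent n m L)
      ≤ ∑ p ∈ (Finset.univ ×ˢ Finset.range L : Finset (ZMod m × ℕ)),
          binomialProb ((p.2 + 1) * n) ((p.2 + 1) * m) :=
        (measureReal_biUnion_finset_le _ _).trans
          (Finset.sum_le_sum fun _ _ => crsfMeasure_real_pathEvent_le _ _ _)
    _ = m * ∑ k ∈ Finset.range L, binomialProb ((k + 1) * n) ((k + 1) * m) := by
        simp only [Finset.sum_product, Finset.sum_const, Finset.card_univ, ZMod.card, nsmul_eq_mul]

theorem crsfMeasure_real_offDiagonalEvent_le {L : ℕ} {x : ℝ} (hx₀ : 0 ≤ x)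
    (hx : ∀ i j, i ≠ j → i * n + j * m < L → binomialProb (i * n) (j * m) ≤ x) :
    (crsfMeasure n m).real (offDiagonalEvent n m L) ≤ n * m * L ^ 2 * x := by
  refine (measureReal_biUnion_finset_le _ _).trans ((Finset.sum_le_card_nsmul _ _ x ?_).trans ?_)
  · rintro ⟨u, i, j⟩ hp
    simp only [Finset.mem_product, Finset.mem_filter] at hp
    exact (crsfMeasure_real_pathEvent_le _ _ _).trans (hx i j hp.2.2.1 hp.2.2.2)
  · rw [Finset.card_product, Finset.card_univ, Fintype.card_prod, ZMod.card, ZMod.card,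
      nsmul_eq_mul]
    gcongr
    have := Finset.card_filter_le (Finset.range L ×ˢ Finset.range L)
      fun q => q.1 ≠ q.2 ∧ q.1 * n + q.2 * m < L
    rw [Finset.card_product, Finset.card_range, ← sq] at this
    exact_mod_cast Nat.mul_le_mul_left (n * m) this

theorem crsfMeasure_real_longEvent_le {L : ℕ} {R : ℝ} (hR : 0 < R) (hL : 2 * (n * m) ≤ L * R) :
    (crsfMeasure n m).real (longEvent n m L) ≤
      2 * (n * m) ^ 2 * Real.exp (-(L / (16 * R ^ 2))) := by
  refine (measureReal_biUnion_finset_le _ _).trans ((Finset.sum_le_card_nsmul _ _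
    (2 * Real.exp (-(L / (16 * R ^ 2)))) ?_).trans_eq ?_)
  · rintro ⟨v, g⟩ hp
    simp only [Finset.mem_product, Finset.mem_Icc] at hp
    exact crsfMeasure_real_gapEvent_le v (by lia) hR hL
  · have hcard : (Finset.Icc 1 (n * m : ℤ)).card = n * m := by
      rw [Int.card_Icc, add_sub_cancel_right]
      exact_mod_cast Int.toNat_natCast (n * m)
    rw [Finset.card_product, Finset.card_univ, Fintype.card_prod, ZMod.card, ZMod.card, hcard,
      nsmul_eq_mul]
    push_cast
    ring

theorem crsfMeasure_real_twoDisjointCycles_le {L : ℕ} {R x : ℝ} (hR : 0 < R)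
    (hL : 2 * (n * m) ≤ L * R) (hx₀ : 0 ≤ x)
    (hx : ∀ i j, i ≠ j → i * n + j * m < L → binomialProb (i * n) (j * m) ≤ x) :
    (crsfMeasure n m).real (twoDisjointCycles n m) ≤
      m * ∑ k ∈ Finset.range L, binomialProb ((k + 1) * n) ((k + 1) * m) + n * m * L ^ 2 * x +
        2 * (n * m) ^ 2 * Real.exp (-(L / (16 * R ^ 2))) :=
  calc (crsfMeasure n m).real (twoDisjointCycles n m)
      ≤ (crsfMeasure n m).real
          (diagonalEvent n m L ∪ offDiagonalEvent n m L ∪ longEvent n m L) :=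
        measureReal_mono (twoDisjointCycles_subset L)
    _ ≤ (crsfMeasure n m).real (diagonalEvent n m L) +
          (crsfMeasure n m).real (offDiagonalEvent n m L) +
            (crsfMeasure n m).real (longEvent n m L) :=
        (measureReal_union_le _ _).trans (by gcongr; exact measureReal_union_le _ _)
    _ ≤ _ := by
        gcongr
        · exact crsfMeasure_real_diagonalEvent_le L
        · exact crsfMeasure_real_offDiagonalEvent_le hx₀ hx
        · exact crsfMeasure_real_longEvent_le hR hL

end UnionBound

/-! ### Almost square tori -/

section AlmostSquare

variable {n m : ℕ}

theorem binomialProb_mul_mul_le (n m : ℕ) {k : ℕ} (hk : 0 < k) :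
    binomialProb (k * n) (k * m) ≤
      1 / √(2 * min (n : ℝ) m + 1) *
        Real.exp (-(((n : ℝ) - m) ^ 2 / (4 * max (n : ℝ) m))) ^ k := by
  have hk₁ : (1 : ℝ) ≤ k := by exact_mod_cast hk
  have hmin : min (n : ℝ) m ≤ k * min (n : ℝ) m :=
    le_mul_of_one_le_left (by positivity) hk₁
  refine (binomialProb_le _ _).trans ?_
  push_cast
  rw [← mul_min_of_nonneg _ _ k.cast_nonneg, ← mul_max_of_nonneg _ _ k.cast_nonneg,
    ← Real.exp_nat_mul]
  gcongr
  apply le_of_eq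
  field_simp

theorem sum_binomialProb_mul_mul_le (L : ℕ)
    (hq : Real.exp (-(((n : ℝ) - m) ^ 2 / (4 * max (n : ℝ) m))) ≤ 1 / 2) :
    ∑ k ∈ Finset.range L, binomialProb ((k + 1) * n) ((k + 1) * m) ≤
      2 / √(2 * min (n : ℝ) m + 1) *
        Real.exp (-(((n : ℝ) - m) ^ 2 / (4 * max (n : ℝ) m))) := by
  set q := Real.exp (-(((n : ℝ) - m) ^ 2 / (4 * max (n : ℝ) m)))
  have hq₀ : 0 ≤ q := (Real.exp_pos _).le
  have hgeom : ∑ k ∈ Finset.range L, q ^ k ≤ 2 := by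
    calc ∑ k ∈ Finset.range L, q ^ k ≤ ∑' k, q ^ k :=
          (summable_geometric_of_lt_one hq₀ (by linarith)).sum_le_tsum _ fun k _ => pow_nonneg hq₀ k
      _ = (1 - q)⁻¹ := tsum_geometric_of_lt_one hq₀ (by linarith)
      _ ≤ 2 := by rw [inv_le_comm₀] <;> linarith
  calc ∑ k ∈ Finset.range L, binomialProb ((k + 1) * n) ((k + 1) * m)
      ≤ ∑ k ∈ Finset.range L, 1 / √(2 * min (n : ℝ) m + 1) * q ^ (k + 1) :=
        Finset.sum_le_sum fun k _ => binomialProb_mul_mul_le n m k.succ_pos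
    _ = 1 / √(2 * min (n : ℝ) m + 1) * (∑ k ∈ Finset.range L, q ^ k) * q := by
        simp only [pow_succ, ← mul_assoc, Finset.sum_mul, Finset.mul_sum]
    _ ≤ 1 / √(2 * min (n : ℝ) m + 1) * 2 * q := by gcongr
    _ = 2 / √(2 * min (n : ℝ) m + 1) * q := by ring

variable {r : ℝ}

theorem three_quarters_mul_le_and_le (hr : 1 ≤ r) (hn : (n : ℝ) = r ^ 5)
    (hm : |(m : ℝ) - n| ≤ r ^ 3 / 4) : 3 / 4 * r ^ 5 ≤ m ∧ (m : ℝ) ≤ 5 / 4 * r ^ 5 := by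
  have h35 : r ^ 3 ≤ r ^ 5 := pow_le_pow_right₀ hr (by norm_num)
  obtain ⟨hlower, hupper⟩ := abs_le.mp hm
  constructor <;> linarith

theorem mul_sum_binomialProb_mul_mul_le (hr : 1 ≤ r) (hn : (n : ℝ) = r ^ 5)
    (hm : |(m : ℝ) - n| ≤ r ^ 3 / 4) (L : ℕ)
    (hq : Real.exp (-(((n : ℝ) - m) ^ 2 / (4 * max (n : ℝ) m))) ≤ 1 / 2) :
    m * ∑ k ∈ Finset.range L, binomialProb ((k + 1) * n) ((k + 1) * m) ≤
      4 * √n * Real.exp (-(((n : ℝ) - m) ^ 2 / (4 * max (n : ℝ) m))) := by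
  obtain ⟨hlower, hupper⟩ := three_quarters_mul_le_and_le hr hn hm
  have hmin : (n : ℝ) ≤ 2 * min (n : ℝ) m + 1 := by
    have : 3 / 4 * (n : ℝ) ≤ min (n : ℝ) m := le_min (by linarith [n.cast_nonneg (α := ℝ)])
      (hn ▸ hlower)
    linarith [n.cast_nonneg (α := ℝ)]
  have hprefactor : m * (2 / √(2 * min (n : ℝ) m + 1)) ≤ 4 * √n := by
    rw [← mul_div_assoc, div_le_iff₀ (by positivity)]
    calc (m : ℝ) * 2 ≤ 4 * n := by linarith
      _ = 4 * √n * √n := by rw [mul_assoc, Real.mul_self_sqrt n.cast_nonneg]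
      _ ≤ 4 * √n * √(2 * min (n : ℝ) m + 1) := by gcongr
  calc m * ∑ k ∈ Finset.range L, binomialProb ((k + 1) * n) ((k + 1) * m)
      ≤ m * (2 / √(2 * min (n : ℝ) m + 1) *
          Real.exp (-(((n : ℝ) - m) ^ 2 / (4 * max (n : ℝ) m)))) := by
        gcongr
        exact sum_binomialProb_mul_mul_le L hq
    _ ≤ _ := by
        rw [← mul_assoc]
        gcongr

theorem half_le_abs_mul_sub_mul (hr : 1 ≤ r) (hn : (n : ℝ) = r ^ 5)
    (hm : |(m : ℝ) - n| ≤ r ^ 3 / 4) {i j : ℕ} (hij : i ≠ j)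
    (hlen : (i * n + j * m : ℝ) < r ^ 7) : r ^ 5 / 2 ≤ |(i * n - j * m : ℝ)| := by
  obtain ⟨hlower, -⟩ := three_quarters_mul_le_and_le hr hn hm
  have hj : (j : ℝ) ≤ 4 / 3 * r ^ 2 := by
    have hjm : j * (3 / 4 * r ^ 5) ≤ 4 / 3 * r ^ 2 * (3 / 4 * r ^ 5) :=
      calc j * (3 / 4 * r ^ 5) ≤ j * m := by gcongr
        _ ≤ r ^ 7 := by linarith [mul_nonneg (i.cast_nonneg (α := ℝ)) (n.cast_nonneg (α := ℝ))]
        _ = 4 / 3 * r ^ 2 * (3 / 4 * r ^ 5) := by ring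
    exact le_of_mul_le_mul_right hjm (by positivity)
  have hdiff : |(j : ℝ) * (m - n)| ≤ r ^ 5 / 3 :=
    calc |(j : ℝ) * (m - n)| = j * |(m : ℝ) - n| := by rw [abs_mul, Nat.abs_cast]
      _ ≤ 4 / 3 * r ^ 2 * (r ^ 3 / 4) := by gcongr
      _ = r ^ 5 / 3 := by ring
  have hwinding : (1 : ℝ) ≤ |(i : ℝ) - j| := by
    have : (1 : ℤ) ≤ |(i : ℤ) - j| := Int.one_le_abs (sub_ne_zero.mpr (by exact_mod_cast hij))
    exact_mod_cast this
  calc r ^ 5 / 2 ≤ 1 * r ^ 5 - r ^ 5 / 3 := by linarith [pow_pos (zero_lt_one.trans_le hr) 5]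
    _ ≤ |((i : ℝ) - j) * n| - |(j : ℝ) * (m - n)| := by
        rw [abs_mul, Nat.abs_cast, hn]
        rw [hn] at hdiff
        gcongr
    _ ≤ |((i : ℝ) - j) * n - j * (m - n)| := abs_sub_abs_le_abs_sub _ _
    _ = |(i * n - j * m : ℝ)| := by ring_nf

theorem binomialProb_mul_mul_le_exp_of_ne (hr : 1 ≤ r) (hn : (n : ℝ) = r ^ 5)
    (hm : |(m : ℝ) - n| ≤ r ^ 3 / 4) {i j : ℕ} (hij : i ≠ j)
    (hlen : (i * n + j * m : ℝ) < r ^ 7) :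
    binomialProb (i * n) (j * m) ≤ Real.exp (-(r / 256)) := by
  have hfar := half_le_abs_mul_sub_mul hr hn hm hij hlen
  have hin : (0 : ℝ) ≤ i * n := by positivity
  have hjm : (0 : ℝ) ≤ j * m := by positivity
  have hmax : max (i * n : ℝ) (j * m) ≤ r ^ 7 := max_le (by linarith) (by linarith)
  have hmax₀ : 0 < max (i * n : ℝ) (j * m) := by
    have : 0 < r ^ 5 / 2 := by positivity
    have := abs_pos.mp (this.trans_le hfar)
    by_contra! hle
    exact this (by linarith [le_max_left (i * n : ℝ) (j * m), le_max_right (i * n : ℝ) (j * m)])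
  refine (binomialProb_le_exp _ _).trans (Real.exp_le_exp.mpr (neg_le_neg ?_))
  push_cast
  calc r / 256 ≤ r ^ 3 / 16 := by
        have : r ^ 1 ≤ r ^ 3 := pow_le_pow_right₀ hr (by norm_num)
        linarith
    _ = (r ^ 5 / 2) ^ 2 / (4 * r ^ 7) := by
        field_simp
        ring
    _ ≤ (i * n - j * m : ℝ) ^ 2 / (4 * max (i * n : ℝ) (j * m)) := by
        rw [← sq_abs (i * n - j * m : ℝ)]
        gcongr

theorem crsfMeasure_real_twoDisjointCycles_le_sum_add [NeZero n] [NeZero m] (hr : 1 ≤ r)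
    (hn : (n : ℝ) = r ^ 5) (hm : |(m : ℝ) - n| ≤ r ^ 3 / 4) :
    (crsfMeasure n m).real (twoDisjointCycles n m) ≤
      m * ∑ k ∈ Finset.range ⌈r ^ 7⌉₊, binomialProb ((k + 1) * n) ((k + 1) * m) +
        9 * n ^ 6 * Real.exp (-(r / 256)) := by
  -- Any power of `n` between `4 / 3` (for `longEvent`) and `3 / 2` (for `offDiagonalEvent`) could
  -- serve as the bound on the length of short cycles.
  set L := ⌈r ^ 7⌉₊
  have hrL : r ^ 7 ≤ L := Nat.le_ceil _
  have hmn : (m : ℝ) ≤ 5 / 4 * n := hn ▸ (three_quarters_mul_le_and_le hr hn hm).2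
  have hLn : (L : ℝ) ≤ 2 * n ^ 2 :=
    calc (L : ℝ) ≤ r ^ 7 + 1 := (Nat.ceil_lt_add_one (by positivity)).le
      _ ≤ r ^ 10 + r ^ 10 :=
          add_le_add (pow_le_pow_right₀ hr (by norm_num)) (one_le_pow₀ hr)
      _ = 2 * n ^ 2 := by rw [hn]; ring
  have hlong : 2 * (n * m) ≤ L * (4 * r ^ 3) :=
    calc (2 * (n * m) : ℝ) ≤ 2 * (n * (5 / 4 * n)) := by gcongr
      _ ≤ r ^ 7 * (4 * r ^ 3) := by rw [hn]; linarith [pow_pos (zero_lt_one.trans_le hr) 10]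
      _ ≤ L * (4 * r ^ 3) := by gcongr
  have hexp : Real.exp (-(L / (16 * (4 * r ^ 3) ^ 2))) ≤ Real.exp (-(r / 256)) := by
    refine Real.exp_le_exp.mpr (neg_le_neg ?_)
    rw [div_le_div_iff₀ (by positivity) (by positivity)]
    linarith
  have hoff (i j : ℕ) (hij : i ≠ j) (hlen : i * n + j * m < L) :
      binomialProb (i * n) (j * m) ≤ Real.exp (-(r / 256)) :=
    binomialProb_mul_mul_le_exp_of_ne hr hn hm hij (by exact_mod_cast Nat.lt_ceil.mp hlen)
  refine (crsfMeasure_real_twoDisjointCycles_le (by positivity) hlong (Real.exp_pos _).le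
    hoff).trans ?_
  have hprefactor : (n * m * L ^ 2 + 2 * (n * m) ^ 2 : ℝ) ≤ 9 * n ^ 6 :=
    calc (n * m * L ^ 2 + 2 * (n * m) ^ 2 : ℝ)
        ≤ n * (5 / 4 * n) * (2 * n ^ 2) ^ 2 + 2 * (n * (5 / 4 * n)) ^ 2 := by gcongr
      _ = 5 * n ^ 6 + 25 / 8 * n ^ 4 := by ring
      _ ≤ 5 * n ^ 6 + 4 * n ^ 6 := by
          gcongr <;> norm_num
          exact NeZero.one_le
      _ = 9 * n ^ 6 := by ring
  rw [add_assoc]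
  gcongr
  refine le_trans ?_ (mul_le_mul_of_nonneg_right hprefactor (Real.exp_pos _).le)
  rw [add_mul]
  gcongr

theorem crsfMeasure_real_twoDisjointCycles_le_exp_add (hr : 1 ≤ r) (hn : (n : ℝ) = r ^ 5)
    (hm : |(m : ℝ) - n| ≤ r ^ 3 / 4) :
    (crsfMeasure n m).real (twoDisjointCycles n m) ≤
      4 * √n * Real.exp (-(((n : ℝ) - m) ^ 2 / (4 * max (n : ℝ) m))) +
        9 * n ^ 6 * Real.exp (-(r / 256)) := by
  have hn₁ : (1 : ℝ) ≤ n := hn ▸ one_le_pow₀ hr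
  have hm₀ : (0 : ℝ) < m := by linarith [(three_quarters_mul_le_and_le hr hn hm).1]
  have : NeZero n := ⟨by rintro rfl; norm_num at hn₁⟩
  have : NeZero m := ⟨by exact_mod_cast hm₀.ne'⟩
  rcases lt_or_ge (1 / 2) (Real.exp (-(((n : ℝ) - m) ^ 2 / (4 * max (n : ℝ) m)))) with hq | hq
  · calc (crsfMeasure n m).real (twoDisjointCycles n m) ≤ 4 * 1 * (1 / 2) + 0 := by
          linarith [measureReal_le_one (μ := crsfMeasure n m) (s := twoDisjointCycles n m)]
      _ ≤ _ := by
          gcongr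
          · exact Real.one_le_sqrt.mpr hn₁
          · positivity
  · refine (crsfMeasure_real_twoDisjointCycles_le_sum_add hr hn hm).trans ?_
    exact add_le_add (mul_sum_binomialProb_mul_mul_le hr hn hm _ hq) le_rfl

end AlmostSquare

/-! ### Asymptotics -/

section Asymptotics

variable {m : ℕ → ℕ} {D : ℝ}

theorem tendsto_sq_sub_div_rpow
    (h : Tendsto (fun n : ℕ => ((m n : ℝ) - n) ^ 2 / (n * Real.log n)) atTop (𝓝 D)) {p : ℝ}
    (hp : 1 < p) : Tendsto (fun n : ℕ => ((m n : ℝ) - n) ^ 2 / (n : ℝ) ^ p) atTop (𝓝 0) := by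
  have hlog : Tendsto (fun n : ℕ => Real.log n / (n : ℝ) ^ (p - 1)) atTop (𝓝 0) :=
    (isLittleO_log_rpow_atTop (sub_pos.mpr hp)).tendsto_div_nhds_zero.comp
      tendsto_natCast_atTop_atTop
  refine (mul_zero D ▸ h.mul hlog).congr' ?_
  filter_upwards [eventually_ge_atTop 2] with n hn
  have hn₁ : (1 : ℝ) < n := by exact_mod_cast hn
  have hlog₀ := Real.log_pos hn₁
  have hpow : (n : ℝ) ^ p = n * (n : ℝ) ^ (p - 1) := by
    rw [Real.rpow_sub_one (by positivity)]
    field_simp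
  rw [hpow]
  field_simp

theorem eventually_abs_sub_le
    (h : Tendsto (fun n : ℕ => ((m n : ℝ) - n) ^ 2 / (n * Real.log n)) atTop (𝓝 D)) :
    ∀ᶠ n : ℕ in atTop, |(m n : ℝ) - n| ≤ ((n : ℝ) ^ (1 / 5 : ℝ)) ^ 3 / 4 := by
  have hlim := tendsto_sq_sub_div_rpow h (p := 6 / 5) (by norm_num)
  filter_upwards [hlim.eventually_le_const (u := 1 / 16) (by norm_num), eventually_gt_atTop 0]
    with n hle hn
  have hn₀ : (0 : ℝ) < n := by exact_mod_cast hn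
  refine abs_le_of_sq_le_sq ?_ (by positivity)
  rw [div_le_iff₀ (by positivity)] at hle
  calc ((m n : ℝ) - n) ^ 2 ≤ 1 / 16 * (n : ℝ) ^ (6 / 5 : ℝ) := hle
    _ = (((n : ℝ) ^ (1 / 5 : ℝ)) ^ 3 / 4) ^ 2 := by
        rw [div_pow, ← pow_mul, ← Real.rpow_mul_natCast hn₀.le]
        norm_num
        ring

theorem tendsto_max_div
    (h : Tendsto (fun n : ℕ => ((m n : ℝ) - n) ^ 2 / (n * Real.log n)) atTop (𝓝 D)) :
    Tendsto (fun n : ℕ => max (n : ℝ) (m n) / n) atTop (𝓝 1) := by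
  have hsq : Tendsto (fun n : ℕ => (((m n : ℝ) - n) / n) ^ 2) atTop (𝓝 0) := by
    simpa only [Real.rpow_two, ← div_pow] using tendsto_sq_sub_div_rpow h one_lt_two
  have hdiff : Tendsto (fun n : ℕ => ((m n : ℝ) - n) / n) atTop (𝓝 0) := by
    rw [tendsto_zero_iff_abs_tendsto_zero]
    simpa [Function.comp_def, Real.sqrt_sq_eq_abs] using hsq.sqrt
  have hmax := (tendsto_const_nhds (x := (1 : ℝ))).max (hdiff.const_add 1)
  rw [add_zero, max_self] at hmax
  refine hmax.congr' ?_
  filter_upwards [eventually_gt_atTop 0] with n hn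
  have hn₀ : (0 : ℝ) < n := by exact_mod_cast hn
  rw [← max_div_div_right hn₀.le, sub_div, div_self hn₀.ne', add_sub_cancel]

theorem eventually_exp_le_rpow
    (h : Tendsto (fun n : ℕ => ((m n : ℝ) - n) ^ 2 / (n * Real.log n)) atTop (𝓝 D)) {κ : ℝ}
    (hκ : κ < D / 4) :
    ∀ᶠ n : ℕ in atTop,
      Real.exp (-(((n : ℝ) - m n) ^ 2 / (4 * max (n : ℝ) (m n)))) ≤ (n : ℝ) ^ (-κ) := by
  have hlim := h.div ((tendsto_max_div h).const_mul 4) (by norm_num)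
  rw [mul_one] at hlim
  filter_upwards [hlim.eventually_const_lt hκ, eventually_ge_atTop 2] with n hlt hn
  have hn₁ : (1 : ℝ) < n := by exact_mod_cast hn
  have hn₀ : (0 : ℝ) < n := zero_lt_one.trans hn₁
  have hlog := Real.log_pos hn₁
  have hmax : 0 < max (n : ℝ) (m n) := lt_max_of_lt_left hn₀
  have hexponent : ((n : ℝ) - m n) ^ 2 / (4 * max (n : ℝ) (m n)) =
      ((m n : ℝ) - n) ^ 2 / (n * Real.log n) / (4 * (max (n : ℝ) (m n) / n)) * Real.log n := by
    rw [sub_sq_comm]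
    field_simp
  rw [Real.rpow_def_of_pos hn₀, Real.exp_le_exp, hexponent]
  rw [Pi.div_apply] at hlt
  linarith [mul_le_mul_of_nonneg_right hlt.le hlog.le]

theorem eventually_mul_pow_mul_exp_le_rpow (c : ℝ) (k : ℕ) {a b : ℝ} (ha : 0 < a) (hb : 0 < b)
    (β : ℝ) :
    ∀ᶠ n : ℕ in atTop, c * n ^ k * Real.exp (-((n : ℝ) ^ a / b)) ≤ (n : ℝ) ^ β / 2 := by
  have hexp := (isLittleO_exp_neg_mul_rpow_atTop (inv_pos.mpr hb) ((β - k) / a)).comp_tendsto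
    ((tendsto_rpow_atTop ha).comp tendsto_natCast_atTop_atTop)
  have hpow := (Asymptotics.isBigO_refl (fun n : ℕ => (n : ℝ) ^ k) atTop).const_mul_left c
  filter_upwards [(hpow.mul_isLittleO hexp).bound one_half_pos, eventually_gt_atTop 0] with n hle hn
  have hn₀ : (0 : ℝ) < n := by exact_mod_cast hn
  have hrpow : (n : ℝ) ^ k * ((n : ℝ) ^ a) ^ ((β - k) / a) = (n : ℝ) ^ β := by
    rw [← Real.rpow_mul hn₀.le, mul_div_cancel₀ _ ha.ne', ← Real.rpow_natCast,
      ← Real.rpow_add hn₀, add_sub_cancel]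
  simp only [Function.comp_apply, hrpow] at hle
  rw [Real.norm_of_nonneg (r := (n : ℝ) ^ β) (by positivity), neg_mul, inv_mul_eq_div] at hle
  linarith [(le_abs_self _).trans hle]

theorem tendsto_sq_sub_div_of_eventually_eq {C : ℝ} {δ : ℕ → ℝ} (hδ : Tendsto δ atTop (𝓝 0))
    (hm : ∀ᶠ n : ℕ in atTop,
      (m n : ℝ) = (n : ℝ) + C * Real.sqrt ((n : ℝ) * Real.log (n : ℝ)) * (1 + δ n)) :
    Tendsto (fun n : ℕ => ((m n : ℝ) - n) ^ 2 / (n * Real.log n)) atTop (𝓝 (C ^ 2)) := by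
  have hlim := ((hδ.const_add 1).pow 2).const_mul (C ^ 2)
  rw [add_zero, one_pow, mul_one] at hlim
  refine hlim.congr' ?_
  filter_upwards [hm, eventually_ge_atTop 2] with n hmn hn
  have hn₁ : (1 : ℝ) < n := by exact_mod_cast hn
  have hpos : 0 < n * Real.log n := mul_pos (zero_lt_one.trans hn₁) (Real.log_pos hn₁)
  rw [hmn, add_sub_cancel_left, mul_pow, mul_pow, Real.sq_sqrt hpos.le, eq_div_iff hpos.ne']
  ring

end Asymptotics

end CRSF

theorem mainTheorem4_general (m : ℕ → ℕ) (D : ℝ)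
    (hm : Tendsto (fun n : ℕ => ((m n : ℝ) - n) ^ 2 / (n * Real.log n)) atTop (𝓝 D))
    (ε : ℝ) (hε : 0 < ε) :
    ∀ᶠ n : ℕ in atTop,
      (CRSF.crsfMeasure n (m n)).real (CRSF.twoDisjointCycles n (m n)) ≤
        (n : ℝ) ^ ((1 : ℝ) / 2 - D / 4 + ε) := by
  set β := (1 : ℝ) / 2 - D / 4 + ε
  have hpow : ∀ᶠ n : ℕ in atTop, 8 ≤ (n : ℝ) ^ (ε / 2) :=
    ((tendsto_rpow_atTop (half_pos hε)).comp tendsto_natCast_atTop_atTop).eventually_ge_atTop 8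
  filter_upwards [CRSF.eventually_abs_sub_le hm, eventually_ge_atTop 1, hpow,
    CRSF.eventually_exp_le_rpow hm (κ := D / 4 - ε / 2) (by linarith),
    CRSF.eventually_mul_pow_mul_exp_le_rpow 9 6 (a := 1 / 5) (b := 256) (by norm_num)
      (by norm_num) β] with n hclose hn hpow hdiagonal herror
  have hn₁ : (1 : ℝ) ≤ n := by exact_mod_cast hn
  have hfifth : (n : ℝ) = ((n : ℝ) ^ (1 / 5 : ℝ)) ^ 5 := by
    rw [← Real.rpow_mul_natCast n.cast_nonneg]
    norm_num
  calc (CRSF.crsfMeasure n (m n)).real (CRSF.twoDisjointCycles n (m n))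
      ≤ _ := CRSF.crsfMeasure_real_twoDisjointCycles_le_exp_add
        (Real.one_le_rpow hn₁ (by norm_num)) hfifth hclose
    _ ≤ 4 * √n * (n : ℝ) ^ (-(D / 4 - ε / 2)) + (n : ℝ) ^ β / 2 := by gcongr
    _ = 4 * (n : ℝ) ^ (β - ε / 2) + (n : ℝ) ^ β / 2 := by
        rw [Real.sqrt_eq_rpow, mul_assoc, ← Real.rpow_add (by positivity)]
        congr 3
        ring
    _ ≤ (n : ℝ) ^ (ε / 2) / 2 * (n : ℝ) ^ (β - ε / 2) + (n : ℝ) ^ β / 2 := by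
        gcongr
        linarith
    _ = (n : ℝ) ^ β := by
        rw [div_mul_eq_mul_div, ← Real.rpow_add (by positivity), add_sub_cancel, add_halves]

theorem mainTheorem4 (C : ℝ) (hC : Real.sqrt 2 < |C|) (m : ℕ → ℕ) (δ : ℕ → ℝ)
    (hδ : Tendsto δ atTop (𝓝 0))
    (hm : ∀ᶠ n : ℕ in atTop,
      (m n : ℝ) = (n : ℝ) + C * Real.sqrt ((n : ℝ) * Real.log (n : ℝ)) * (1 + δ n))
    (ε : ℝ) (hε : 0 < ε) :
    ∀ᶠ n : ℕ in atTop,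
      (CRSF.crsfMeasure n (m n)).real (CRSF.twoDisjointCycles n (m n)) ≤
        (n : ℝ) ^ ((1 : ℝ) / 2 - C ^ 2 / 4 + ε) :=
  mainTheorem4_general m (C ^ 2) (CRSF.tendsto_sq_sub_div_of_eventually_eq hδ hm) ε hε
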